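/- A cylindric partition of rank $r\ge 1$ with profile $c=(c_1,\dots,c_r)\in\mathbb{Z}_{\ge 0}^r$ is a tuple $\Lambda=(\lambda^{(1)},\dots,\lambda^{(r)})$ of ordinary partitions $\lambda^{(i)}=(\lambda^{(i)}_1\ge\lambda^{(i)}_2\ge\cdots)$, each padded with zeros, such that for all $j\ge 1$ $$\lambda^{(i)}_j\ \ge\ \lambda^{(i+1)}_{j+c_{i+1}}\quad(1\le i<r),\qquad \lambda^{(r)}_j\ \ge\ \lambda^{(1)}_{j+c_1}.$$ Its size $|\Lambda|$ is the sum of all parts of all the $\lambda^{(i)}$, and $P_c$ denotes the set of all cylindric partitions with profile $c$. For $a,q\in\mathbb{C}$ with $|q|<1$ write $(a;q)_n=\prod_{k=1}^{n}(1-aq^{k-1})$ and $(a;q)_\infty=\lim_{n\to\infty}(a;q)_n$. Theorem. Let $q\in\mathbb{C}$ with $|q|<1$. Then the generating function of cylindric partitions with profile $c=(2,0,0)$ (rank $3$, level $2$) converges absolutely and $$\sum_{\Lambda\in P_{(2,0,0)}} q^{|\Lambda|}\ =\ \Bigl(\sum_{n\ge 0}\frac{q^{n^2+2n}}{(q^4;q^4)_n}\Bigr)\cdot\frac{(-q^2;q^2)_\infty}{(q;q)_\infty},$$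 where the series on the right converges absolutely as well. The generating function $\sum_{\Lambda\in P_{(3,0)}} q^{|\Lambda|}$ of cylindric partitions with profile $(3,0)$ (rank $2$, level $3$) also converges absolutely and has the same value. -/

import Mathlib

open Filter Topology

/-- A cylindric partition of rank `r` with profile `c = (c₁, …, c_r)`.
The rows are ordinary partitions, i.e. weakly decreasing finite sequences of parts, padded with
zeros; rows and columns are numbered from `0`. Since `i + 1` is cyclic in `Fin r`, the last field
contains both `λ⁽ⁱ⁾_j ≥ λ⁽ⁱ⁺¹⁾_{j + c_{i+1}}` for `i < r` and `λ⁽ʳ⁾_j ≥ λ⁽¹⁾_{j + c₁}`. -/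
structure CylindricPartition {r : ℕ} [NeZero r] (c : Fin r → ℕ) where
  row : Fin r → ℕ →₀ ℕ
  antitone_row : ∀ i, Antitone (row i)
  row_succ_le : ∀ i j, row (i + 1) (j + c (i + 1)) ≤ row i j

/-- The size `|Λ|`: the sum of all parts of all rows. -/
def CylindricPartition.size {r : ℕ} [NeZero r] {c : Fin r → ℕ} (L : CylindricPartition c) : ℕ :=
  ∑ i, (L.row i).sum fun _ part => part

/-- The finite `q`-Pochhammer symbol `(a; q)_n`. -/
noncomputable def qPochhammer (a q : ℂ) (n : ℕ) : ℂ :=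
  ∏ k ∈ Finset.range n, (1 - a * q ^ k)

/-- The infinite `q`-Pochhammer symbol `(a; q)_∞`, for `‖q‖ < 1`. -/
noncomputable def qPochhammerInf (a q : ℂ) : ℂ :=
  ∏' k : ℕ, (1 - a * q ^ k)

/-- `(a; q)_∞` is the limit of `(a; q)_n` whenever `‖q‖ < 1`. -/
theorem tendsto_qPochhammer (a : ℂ) {q : ℂ} (hq : ‖q‖ < 1) :
    Tendsto (qPochhammer a q) atTop (𝓝 (qPochhammerInf a q)) := by
  have hs : Summable fun k : ℕ => ‖-(a * q ^ k)‖ := by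
    simpa [norm_mul, norm_pow] using
      (summable_geometric_of_lt_one (norm_nonneg q) hq).mul_left ‖a‖
  have hm := multipliable_one_add_of_summable hs
  simpa [qPochhammer, qPochhammerInf, sub_eq_add_neg] using! hm.tendsto_prod_tprod_nat

/-! Bound the parts by `n` and recurse on `n`. If some first parts equal `n`, deleting them from a
set `J` of rows lowers the size by `n * J.card` and is a bijection onto the partitions of another
profile with parts at most `n`. Inclusion–exclusion over the rows that can carry the maximum,
together with cyclic symmetry, gives for the pairs (2,0,0), (1,1,0) and (3,0), (2,1) the same system
A_n = A_{n-1} + q^n B_n, B_n = B_{n-1} + q^n A_n + q^n B_n - q^{2n} B_n, with A_0 = B_0 = 1. Its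
solution is `finiteRR q 1`, `finiteRR q 0`, so both generating functions are the limit of `finiteRR
q 1 n`, namely (∑ q^{k²+k}/(q;q)_k) / (q;q)_∞. Rogers' transformation `tsum_rogers`, obtained by
summing a double series in two ways, rewrites the numerator. -/

/-! ### Finitely supported sequences, conjugation and a multiple geometric series -/

/-- The sequence `f` without its first term. -/
noncomputable def Finsupp.tailSeq (f : ℕ →₀ ℕ) : ℕ →₀ ℕ :=
  f.comapDomain Nat.succ Nat.succ_injective.injOn

@[simp] theorem Finsupp.tailSeq_apply (f : ℕ →₀ ℕ) (j : ℕ) : f.tailSeq j = f (j + 1) := rfl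

/-- The sequence `f` with `n` put in front. -/
noncomputable def Finsupp.consSeq (n : ℕ) (f : ℕ →₀ ℕ) : ℕ →₀ ℕ :=
  Finsupp.ofSupportFinite (fun j => Nat.casesOn j n f) <| by
    refine ((f.support.map ⟨Nat.succ, Nat.succ_injective⟩ ∪ {0}).finite_toSet).subset ?_
    intro j hj
    cases j with
    | zero => simp
    | succ j => simpa using hj

@[simp] theorem Finsupp.consSeq_zero (n : ℕ) (f : ℕ →₀ ℕ) : Finsupp.consSeq n f 0 = n := rfl

@[simp] theorem Finsupp.consSeq_succ (n : ℕ) (f : ℕ →₀ ℕ) (j : ℕ) :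
    Finsupp.consSeq n f (j + 1) = f j := rfl

theorem Finsupp.sum_eq_zero_add_tailSeq (f : ℕ →₀ ℕ) :
    (f.sum fun _ p => p) = f 0 + f.tailSeq.sum fun _ p => p := by
  obtain ⟨M, hM⟩ := f.support.exists_nat_subset_range
  rw [Finsupp.sum_of_support_subset f (s := Finset.range (M + 1))
      (hM.trans (Finset.range_mono (Nat.le_succ M))) _ (by simp),
    Finsupp.sum_of_support_subset f.tailSeq (s := Finset.range M) _ _ (by simp),
    Finset.sum_range_succ', add_comm]
  · rfl
  · intro j hj
    have := hM (show j + 1 ∈ f.support by simpa using hj)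
    simp at this ⊢
    omega

/-- The number of terms of `f` that exceed `k`. -/
def Finsupp.countGT (f : ℕ →₀ ℕ) (k : ℕ) : ℕ := (f.support.filter fun j => k < f j).card

theorem Finsupp.lt_countGT_iff {f : ℕ →₀ ℕ} (hf : Antitone f) (k j : ℕ) :
    j < f.countGT k ↔ k < f j := by
  constructor
  · intro h
    by_contra! hk
    have : (f.support.filter fun j => k < f j) ⊆ Finset.range j := by
      intro i hi
      simp only [Finset.mem_filter] at hi
      by_contra! hij
      have := hf (show j ≤ i by simpa using hij)
      omega
    have := Finset.card_le_card this
    rw [Finset.card_range] at this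
    exact absurd h (not_lt.2 this)
  · intro h
    have : Finset.range (j + 1) ⊆ (f.support.filter fun j => k < f j) := by
      intro i hi
      have := hf (show i ≤ j by simp at hi; omega)
      simp only [Finset.mem_filter, Finsupp.mem_support_iff]
      omega
    have := Finset.card_le_card this
    rw [Finset.card_range] at this
    exact this

/-- Double counting of the cells of the Young diagram: the counts are the parts of the conjugate. -/
theorem Finsupp.sum_countGT (f : ℕ →₀ ℕ) {n : ℕ} (hn : ∀ j, f j ≤ n) :
    ∑ k : Fin n, f.countGT k = f.sum fun _ p => p := by
  simp only [Finsupp.countGT, Finset.card_filter, Finsupp.sum]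
  rw [Finset.sum_comm]
  refine Finset.sum_congr rfl fun j _ => ?_
  rw [Fin.sum_univ_eq_sum_range (fun k => if k < f j then 1 else 0) n, ← Finset.card_filter]
  have : (Finset.range n).filter (fun k => k < f j) = Finset.range (f j) := by
    ext k
    have := hn j
    simp
    omega
  rw [this, Finset.card_range]

theorem summable_pow_sum_pi {ι : Type*} [Fintype ι] {x : ℝ} (h0 : 0 ≤ x) (h1 : x < 1) :
    Summable fun m : ι → ℕ => x ^ ∑ i, m i := by
  classical
  refine summable_of_sum_le (c := ∏ _i : ι, (1 - x)⁻¹) (fun m => by positivity) fun s => ?_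
  obtain ⟨M, hM⟩ : ∃ M, ∀ m ∈ s, ∀ i, m i < M := by
    refine ⟨(s.sup fun m => ∑ i, m i) + 1, fun m hm i => Nat.lt_succ_of_le ?_⟩
    exact (Finset.single_le_sum (fun i _ => Nat.zero_le (m i)) (Finset.mem_univ i)).trans
      (Finset.le_sup (f := fun m : ι → ℕ => ∑ i, m i) hm)
  calc ∑ m ∈ s, x ^ ∑ i, m i
      ≤ ∑ m ∈ Fintype.piFinset fun _ : ι => Finset.range M, x ^ ∑ i, m i :=
        Finset.sum_le_sum_of_subset_of_nonneg
          (fun m hm => by simpa using hM m hm) fun _ _ _ => by positivity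
    _ = ∏ _i : ι, ∑ k ∈ Finset.range M, x ^ k := by
        rw [Finset.prod_univ_sum]
        simp only [Finset.prod_pow_eq_pow_sum]
    _ ≤ ∏ _i : ι, (1 - x)⁻¹ := by
        refine Finset.prod_le_prod (fun _ _ => by positivity) fun _ _ => ?_
        rw [← tsum_geometric_of_lt_one h0 h1]
        exact (summable_geometric_of_lt_one h0 h1).sum_le_tsum _ fun _ _ => by positivity

/-! ### Bounded cylindric partitions and the recursion in the largest part -/

namespace CylindricPartition

variable {r : ℕ} [NeZero r] {c : Fin r → ℕ}

theorem ext_row {L M : CylindricPartition c} (h : ∀ i j, L.row i j = M.row i j) : L = M := by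
  have : L.row = M.row := funext fun i => Finsupp.ext (h i)
  cases L
  cases M
  simpa using this

/-- The cylindric partitions with profile `c` all of whose parts are at most `n`. -/
def bounded (c : Fin r → ℕ) (n : ℕ) : Set (CylindricPartition c) := {L | ∀ i, L.row i 0 ≤ n}

/-- The cylindric partitions with profile `c` whose parts are at most `n` and whose rows with
index in `J` start with `n`. -/
def face (c : Fin r → ℕ) (n : ℕ) (J : Finset (Fin r)) : Set (CylindricPartition c) :=
  {L | L ∈ bounded c n ∧ ∀ i ∈ J, L.row i 0 = n}

/-- The generating function by size of the cylindric partitions with parts at most `n`. -/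
noncomputable def boundedGenFun (c : Fin r → ℕ) (n : ℕ) (q : ℂ) : ℂ :=
  ∑' L : bounded c n, q ^ L.1.size

/-- Conjugating every row embeds these partitions into `Fin r × Fin n → ℕ`, turning size into the
sum of coordinates, so a product of finitely many geometric series dominates. -/
theorem summable_bounded (c : Fin r → ℕ) (n : ℕ) {x : ℝ} (h0 : 0 ≤ x) (h1 : x < 1) :
    Summable fun L : bounded c n => x ^ L.1.size := by
  let φ : bounded c n → (Fin r × Fin n → ℕ) := fun L p => (L.1.row p.1).countGT p.2
  have hle (L : bounded c n) (i j) : L.1.row i j ≤ n :=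
    (L.1.antitone_row i (Nat.zero_le j)).trans (L.2 i)
  have hφ : Function.Injective φ := by
    intro L M h
    refine Subtype.ext (ext_row fun i j => ?_)
    refine eq_of_forall_lt_iff fun k => ?_
    by_cases hk : k < n
    · rw [← Finsupp.lt_countGT_iff (L.1.antitone_row i), ← Finsupp.lt_countGT_iff (M.1.antitone_row i)]
      have := congrFun h (i, ⟨k, hk⟩)
      simp only [φ] at this
      rw [this]
    · have := hle L i j
      have := hle M i j
      omega
  refine (summable_congr fun L => ?_).2
    ((summable_pow_sum_pi (ι := Fin r × Fin n) h0 h1).comp_injective hφ)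
  simp only [Function.comp, φ, size]
  rw [Fintype.sum_prod_type]
  congr 1
  exact Finset.sum_congr rfl fun i _ => (Finsupp.sum_countGT _ (hle L i)).symm

theorem boundedGenFun_zero (c : Fin r → ℕ) (q : ℂ) : boundedGenFun c 0 q = 1 := by
  have key (L : bounded c 0) (i j) : L.1.row i j = 0 :=
    Nat.le_zero.1 ((L.1.antitone_row i (Nat.zero_le j)).trans (L.2 i))
  let Z : bounded c 0 := ⟨⟨fun _ => 0, fun _ _ _ _ => le_rfl, fun _ _ => le_rfl⟩, fun _ => le_rfl⟩
  rw [boundedGenFun, tsum_eq_single Z]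
  · simp [Z, size]
  · intro L hL
    exact absurd (Subtype.ext (ext_row fun i j => by rw [key, key])) hL

/-- Removing a part `n` from the front of the rows in `J`. -/
noncomputable def removeFirst {c' : Fin r → ℕ} (J : Finset (Fin r))
    (h : ∀ i, c' (i + 1) + (if i + 1 ∈ J then 1 else 0) = c (i + 1) + if i ∈ J then 1 else 0)
    (L : CylindricPartition c) : CylindricPartition c' where
  row i := if i ∈ J then (L.row i).tailSeq else L.row i
  antitone_row i := by
    split_ifs
    · exact fun a b hab => L.antitone_row i (Nat.succ_le_succ hab)
    · exact L.antitone_row i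
  row_succ_le i j := by
    have hi := h i
    split_ifs at hi ⊢
    · simpa [add_right_comm, show c' (i + 1) = c (i + 1) by omega] using L.row_succ_le i (j + 1)
    · have := L.row_succ_le i j
      rwa [show c (i + 1) = c' (i + 1) + 1 by omega] at this
    · simpa [add_assoc, add_comm 1, show c' (i + 1) = c (i + 1) + 1 by omega] using
        L.row_succ_le i (j + 1)
    · simpa [show c' (i + 1) = c (i + 1) by omega] using L.row_succ_le i j

/-- Putting a part `n` in front of the rows in `J`. -/
noncomputable def addFirst {c' : Fin r → ℕ} (J : Finset (Fin r))
    (h : ∀ i, c' (i + 1) + (if i + 1 ∈ J then 1 else 0) = c (i + 1) + if i ∈ J then 1 else 0)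
    (n : ℕ) (L : CylindricPartition c') (hL : L ∈ bounded c' n) : CylindricPartition c where
  row i := if i ∈ J then (L.row i).consSeq n else L.row i
  antitone_row i := by
    split_ifs
    · refine antitone_nat_of_succ_le fun j => ?_
      cases j with
      | zero => exact hL i
      | succ j => exact L.antitone_row i (Nat.le_succ j)
    · exact L.antitone_row i
  row_succ_le i j := by
    have hi := h i
    have hle (i j) : L.row i j ≤ n := (L.antitone_row i (Nat.zero_le j)).trans (hL i)
    have hle' (i j) : (L.row i).consSeq n j ≤ n := by
      cases j with
      | zero => exact le_rfl
      | succ j => exact hle i j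
    split_ifs at hi ⊢
    · cases j with
      | zero => exact hle' _ _
      | succ j =>
        have := L.row_succ_le i j
        rw [show c' (i + 1) = c (i + 1) by omega] at this
        rwa [add_right_comm]
    · rw [show c (i + 1) = c' (i + 1) + 1 by omega]
      exact L.row_succ_le i j
    · cases j with
      | zero => exact hle _ _
      | succ j =>
        simpa [add_assoc, add_comm 1, show c' (i + 1) = c (i + 1) + 1 by omega] using
          L.row_succ_le i j
    · simpa [show c' (i + 1) = c (i + 1) by omega] using L.row_succ_le i j

theorem size_removeFirst {c' : Fin r → ℕ} (J : Finset (Fin r))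
    (h : ∀ i, c' (i + 1) + (if i + 1 ∈ J then 1 else 0) = c (i + 1) + if i ∈ J then 1 else 0)
    {n : ℕ} {L : CylindricPartition c} (hL : L ∈ face c n J) :
    L.size = n * J.card + (removeFirst J h L).size := by
  have : n * J.card = ∑ i, if i ∈ J then n else 0 := by
    simp [Finset.sum_ite_mem, mul_comm]
  rw [this, size, size, ← Finset.sum_add_distrib]
  refine Finset.sum_congr rfl fun i _ => ?_
  by_cases hi : i ∈ J
  · simp only [removeFirst, hi, if_true]
    rw [Finsupp.sum_eq_zero_add_tailSeq, hL.2 i hi]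
  · simp [removeFirst, hi]

/-- Removing the first part of the rows in `J`, when these are all equal to `n`, is bijective. -/
noncomputable def faceEquiv {c' : Fin r → ℕ} (J : Finset (Fin r))
    (h : ∀ i, c' (i + 1) + (if i + 1 ∈ J then 1 else 0) = c (i + 1) + if i ∈ J then 1 else 0)
    (n : ℕ) : face c n J ≃ bounded c' n where
  toFun L := ⟨removeFirst J h L.1, fun i => by
    by_cases hi : i ∈ J
    · simpa [removeFirst, hi] using (L.1.antitone_row i (Nat.zero_le 1)).trans (L.2.1 i)
    · simpa [removeFirst, hi] using L.2.1 i⟩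
  invFun L := ⟨addFirst J h n L.1 L.2, fun i => by
      by_cases hi : i ∈ J
      · simp [addFirst, hi]
      · simpa [addFirst, hi] using L.2 i,
    fun i hi => by simp [addFirst, hi]⟩
  left_inv L := by
    refine Subtype.ext (ext_row fun i j => ?_)
    by_cases hi : i ∈ J
    · cases j with
      | zero => simp [addFirst, hi, L.2.2 i hi]
      | succ j => simp [addFirst, removeFirst, hi]
    · simp [addFirst, removeFirst, hi]
  right_inv L := by
    refine Subtype.ext (ext_row fun i j => ?_)
    by_cases hi : i ∈ J <;> simp [addFirst, removeFirst, hi]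

/-- Deleting the head of row `i` raises the offset `c (i + 1)` by one, and deleting the head of row
`i + 1` lowers it by one; `h` records this without subtraction in `ℕ`. -/
theorem tsum_face {c' : Fin r → ℕ} (J : Finset (Fin r))
    (h : ∀ i, c' (i + 1) + (if i + 1 ∈ J then 1 else 0) = c (i + 1) + if i ∈ J then 1 else 0)
    (n : ℕ) (q : ℂ) :
    ∑' L : face c n J, q ^ L.1.size = q ^ (n * J.card) * boundedGenFun c' n q := by
  rw [boundedGenFun, ← (faceEquiv J h n).tsum_eq, ← tsum_mul_left]
  refine tsum_congr fun L => ?_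
  rw [size_removeFirst J h L.2, pow_add]
  rfl

/-- Renumbering the rows cyclically. -/
def rotate {c' : Fin r → ℕ} (d : Fin r) (h : ∀ i, c' i = c (i + d)) (L : CylindricPartition c) :
    CylindricPartition c' where
  row i := L.row (i + d)
  antitone_row i := L.antitone_row _
  row_succ_le i j := by
    rw [h, add_right_comm]
    exact L.row_succ_le (i + d) j

theorem boundedGenFun_rotate {c' : Fin r → ℕ} (d : Fin r) (h : ∀ i, c' i = c (i + d)) (n : ℕ)
    (q : ℂ) : boundedGenFun c' n q = boundedGenFun c n q := by
  have h' (i) : c i = c' (i + -d) := by rw [h, neg_add_cancel_right]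
  let e : bounded c n ≃ bounded c' n :=
    { toFun := fun L => ⟨rotate d h L.1, fun i => L.2 _⟩
      invFun := fun L => ⟨rotate (-d) h' L.1, fun i => L.2 _⟩
      left_inv := fun L => Subtype.ext (ext_row fun i j => by simp [rotate])
      right_inv := fun L => Subtype.ext (ext_row fun i j => by simp [rotate]) }
  rw [boundedGenFun, boundedGenFun, ← e.tsum_eq]
  refine tsum_congr fun L => ?_
  congr 1
  exact Equiv.sum_comp (Equiv.addRight d) fun i => (L.1.row i).sum fun _ p => p

theorem summable_indicator {q : ℂ} (hq : ‖q‖ < 1) {n : ℕ} {S : Set (CylindricPartition c)}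
    (hS : S ⊆ bounded c n) : Summable (S.indicator fun L => q ^ L.size) := by
  have : Summable ((bounded c n).indicator fun L => q ^ L.size) := by
    rw [← summable_subtype_iff_indicator]
    refine Summable.of_norm ?_
    simpa [Function.comp_def] using summable_bounded c n (norm_nonneg q) hq
  simpa [Set.indicator_indicator, Set.inter_eq_left.2 hS] using this.indicator S

theorem face_subset (c : Fin r → ℕ) (n : ℕ) (J : Finset (Fin r)) : face c n J ⊆ bounded c n :=
  fun _ h => h.1

theorem bounded_mono (c : Fin r → ℕ) : Monotone (bounded c) :=
  fun _ _ h _ hL i => (hL i).trans h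

/-- The recursion in the largest part for profiles all of whose rows are dominated by row `a`. -/
theorem boundedGenFun_succ_of_dominated {c' : Fin r → ℕ} {a : Fin r}
    (hdom : ∀ (L : CylindricPartition c) i, L.row i 0 ≤ L.row a 0)
    (h : ∀ i, c' (i + 1) + (if i + 1 = a then 1 else 0) = c (i + 1) + if i = a then 1 else 0)
    (n : ℕ) {q : ℂ} (hq : ‖q‖ < 1) :
    boundedGenFun c (n + 1) q =
      boundedGenFun c n q + q ^ (n + 1) * boundedGenFun c' (n + 1) q := by
  classical
  have h1 := tsum_face (c := c) (c' := c') {a} (by simpa using h) (n + 1) q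
  rw [Finset.card_singleton, mul_one] at h1
  rw [← h1, boundedGenFun, boundedGenFun, tsum_subtype _ fun L : CylindricPartition c => q ^ L.size,
    tsum_subtype (bounded c n) fun L => q ^ L.size,
    tsum_subtype (face c (n + 1) {a}) fun L => q ^ L.size,
    ← (summable_indicator hq (bounded_mono c le_rfl)).tsum_add
      (summable_indicator hq (face_subset c _ _))]
  refine tsum_congr fun L => ?_
  -- By domination only the head of row `a` matters: it is at most `n + 1` exactly when it is at
  -- most `n` or equal to `n + 1`.
  have hb (m) : L ∈ bounded c m ↔ L.row a 0 ≤ m :=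
    ⟨fun hL => hL a, fun hL i => (hdom L i).trans hL⟩
  have hf : L ∈ face c (n + 1) {a} ↔ L.row a 0 = n + 1 := by
    simp only [face, Set.mem_ofPred_eq, hb, Finset.mem_singleton, forall_eq]
    omega
  simp only [Set.indicator_apply, hb, hf]
  split_ifs <;> first | omega | simp

/-- The recursion in the largest part for profiles all of whose rows are dominated by row `a` or
row `b`. -/
theorem boundedGenFun_succ_of_dominated_pair {ca cb cab : Fin r → ℕ} {a b : Fin r} (hab : a ≠ b)
    (hdom : ∀ (L : CylindricPartition c) i, L.row i 0 ≤ L.row a 0 ∨ L.row i 0 ≤ L.row b 0)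
    (ha : ∀ i, ca (i + 1) + (if i + 1 = a then 1 else 0) = c (i + 1) + if i = a then 1 else 0)
    (hb : ∀ i, cb (i + 1) + (if i + 1 = b then 1 else 0) = c (i + 1) + if i = b then 1 else 0)
    (hc : ∀ i, cab (i + 1) + (if i + 1 = a ∨ i + 1 = b then 1 else 0) =
      c (i + 1) + if i = a ∨ i = b then 1 else 0)
    (n : ℕ) {q : ℂ} (hq : ‖q‖ < 1) :
    boundedGenFun c (n + 1) q =
      boundedGenFun c n q + q ^ (n + 1) * boundedGenFun ca (n + 1) q +
        q ^ (n + 1) * boundedGenFun cb (n + 1) q -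
        q ^ (2 * (n + 1)) * boundedGenFun cab (n + 1) q := by
  classical
  have h1 := tsum_face (c := c) (c' := ca) {a} (by simpa using ha) (n + 1) q
  have h2 := tsum_face (c := c) (c' := cb) {b} (by simpa using hb) (n + 1) q
  have h3 := tsum_face (c := c) (c' := cab) {a, b} (by simpa using hc) (n + 1) q
  rw [Finset.card_singleton, mul_one] at h1 h2
  rw [Finset.card_pair hab, mul_comm (n + 1)] at h3
  rw [← h1, ← h2, ← h3, boundedGenFun, boundedGenFun, tsum_subtype _ fun L : CylindricPartition c => q ^ L.size,
    tsum_subtype (bounded c n) fun L => q ^ L.size,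
    tsum_subtype (face c (n + 1) {a}) fun L => q ^ L.size, tsum_subtype (face c (n + 1) {b}) fun L => q ^ L.size,
    tsum_subtype (face c (n + 1) {a, b}) fun L => q ^ L.size]
  have s0 := summable_indicator hq (bounded_mono c le_rfl : bounded c n ⊆ bounded c n)
  have s1 (J) := summable_indicator hq (face_subset c (n + 1) J)
  rw [← s0.tsum_add (s1 {a}), ← (s0.add (s1 {a})).tsum_add (s1 {b}),
    ← ((s0.add (s1 {a})).add (s1 {b})).tsum_sub (s1 {a, b})]
  refine tsum_congr fun L => ?_
  -- Pointwise inclusion–exclusion: the maximum `n + 1` is attained by the head of row `a` or of row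
  -- `b`, and the face of `{a, b}` is counted twice.
  have hbd (m) : L ∈ bounded c m ↔ L.row a 0 ≤ m ∧ L.row b 0 ≤ m :=
    ⟨fun hL => ⟨hL a, hL b⟩, fun hL i => (hdom L i).elim (·.trans hL.1) (·.trans hL.2)⟩
  have hf (J : Finset (Fin r)) : L ∈ face c (n + 1) J ↔
    (L.row a 0 ≤ n + 1 ∧ L.row b 0 ≤ n + 1) ∧ ∀ i ∈ J, L.row i 0 = n + 1 := by
    simp only [face, Set.mem_ofPred_eq, hbd]
  simp only [Set.indicator_apply, hbd, hf, Finset.mem_singleton, forall_eq, Finset.mem_insert,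
    forall_eq_or_imp]
  split_ifs <;> first | omega | simp

end CylindricPartition

/-! ### Nonvanishing and bounds for `q`-Pochhammer symbols -/

theorem qPochhammer_zero (a q : ℂ) : qPochhammer a q 0 = 1 := by simp [qPochhammer]

theorem qPochhammer_succ (a q : ℂ) (n : ℕ) :
    qPochhammer a q (n + 1) = qPochhammer a q n * (1 - a * q ^ n) := Finset.prod_range_succ _ _

theorem one_sub_mul_pow_ne_zero {a q : ℂ} (ha : ‖a‖ < 1) (hq : ‖q‖ < 1) (n : ℕ) :
    1 - a * q ^ n ≠ 0 := by
  intro h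
  have h1 : ‖a * q ^ n‖ < 1 := by
    rw [norm_mul, norm_pow]
    exact mul_lt_one_of_nonneg_of_lt_one_left (norm_nonneg a) ha
      (pow_le_one₀ (norm_nonneg q) hq.le)
  rw [← sub_eq_zero.1 h, norm_one] at h1
  exact lt_irrefl _ h1

theorem qPochhammer_ne_zero {a q : ℂ} (ha : ‖a‖ < 1) (hq : ‖q‖ < 1) (n : ℕ) :
    qPochhammer a q n ≠ 0 :=
  Finset.prod_ne_zero_iff.2 fun k _ => one_sub_mul_pow_ne_zero ha hq k

theorem qPochhammerInf_ne_zero {a q : ℂ} (ha : ‖a‖ < 1) (hq : ‖q‖ < 1) :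
    qPochhammerInf a q ≠ 0 := by
  have hs : Summable fun k : ℕ => ‖-(a * q ^ k)‖ := by
    simpa [norm_mul, norm_pow] using
      (summable_geometric_of_lt_one (norm_nonneg q) hq).mul_left ‖a‖
  have := tprod_one_add_ne_zero_of_summable (f := fun k : ℕ => -(a * q ^ k))
    (fun k => by simpa [sub_eq_add_neg] using one_sub_mul_pow_ne_zero ha hq k) hs
  simpa [qPochhammerInf, sub_eq_add_neg] using this

theorem inv_qPochhammer_succ {a q : ℂ} (ha : ‖a‖ < 1) (hq : ‖q‖ < 1) (n : ℕ) :
    (qPochhammer a q (n + 1))⁻¹ * (1 - a * q ^ n) = (qPochhammer a q n)⁻¹ := by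
  rw [qPochhammer_succ, mul_inv, mul_assoc, inv_mul_cancel₀ (one_sub_mul_pow_ne_zero ha hq n),
    mul_one]

theorem exists_norm_inv_qPochhammer_le {a q : ℂ} (ha : ‖a‖ < 1) (hq : ‖q‖ < 1) :
    ∃ C, ∀ n, ‖(qPochhammer a q n)⁻¹‖ ≤ C := by
  obtain ⟨C, hC⟩ := ((tendsto_qPochhammer a hq).inv₀
    (qPochhammerInf_ne_zero ha hq)).norm.bddAbove_range
  exact ⟨C, fun n => hC ⟨n, rfl⟩⟩

/-! ### Finite Rogers–Ramanujan sums solving the recursion -/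

/-- The finite sum `∑ q ^ (k ^ 2 + s k) / ((q; q)_k (q; q)_m)` over `k + m = n`. -/
noncomputable def finiteRR (q : ℂ) (s n : ℕ) : ℂ :=
  ∑ p ∈ Finset.HasAntidiagonal.antidiagonal n,
    q ^ (p.1 ^ 2 + s * p.1) * (qPochhammer q q p.1)⁻¹ * (qPochhammer q q p.2)⁻¹

theorem finiteRR_zero (q : ℂ) (s : ℕ) : finiteRR q s 0 = 1 := by
  simp [finiteRR, qPochhammer_zero]

theorem finiteRR_one_succ {q : ℂ} (hq : ‖q‖ < 1) (n : ℕ) :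
    finiteRR q 1 (n + 1) = finiteRR q 1 n + q ^ (n + 1) * finiteRR q 0 (n + 1) := by
  simp only [finiteRR]
  rw [Finset.Nat.sum_antidiagonal_succ', Finset.Nat.sum_antidiagonal_succ', mul_add (q ^ (n + 1)),
    add_left_comm, Finset.mul_sum, ← Finset.sum_add_distrib]
  congr 1
  · ring
  -- For `k + m = n` the factor is (1 - q^{m+1}) + q^{n+1-k} = 1; the term `k = n + 1` was matched
  -- separately.
  · refine Finset.sum_congr rfl fun p hp => ?_
    rw [← Finset.HasAntidiagonal.mem_antidiagonal.1 hp, ← inv_qPochhammer_succ hq hq p.2]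
    ring

/-- For k + m = n + 1, split 1 - q^{n+1} = (1 - q^m) + q^m (1 - q^k). The first summand lowers `m`,
the second lowers `k`. -/
theorem finiteRR_zero_succ {q : ℂ} (hq : ‖q‖ < 1) (n : ℕ) :
    (1 - q ^ (n + 1)) * finiteRR q 0 (n + 1) = finiteRR q 0 n + q ^ (n + 1) * finiteRR q 1 n := by
  have h : (1 - q ^ (n + 1)) * finiteRR q 0 (n + 1) =
      ∑ p ∈ Finset.HasAntidiagonal.antidiagonal (n + 1),
          (q ^ p.1 ^ 2 * (qPochhammer q q p.1)⁻¹ * ((qPochhammer q q p.2)⁻¹ * (1 - q ^ p.2))) +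
        ∑ p ∈ Finset.HasAntidiagonal.antidiagonal (n + 1), q ^ p.1 ^ 2 * q ^ p.2 *
          ((qPochhammer q q p.1)⁻¹ * (1 - q ^ p.1)) * (qPochhammer q q p.2)⁻¹ := by
    rw [finiteRR, Finset.mul_sum, ← Finset.sum_add_distrib]
    refine Finset.sum_congr rfl fun p hp => ?_
    rw [← Finset.HasAntidiagonal.mem_antidiagonal.1 hp]
    ring
  rw [h, Finset.Nat.sum_antidiagonal_succ', Finset.Nat.sum_antidiagonal_succ]
  simp only [pow_zero, sub_self, mul_zero, zero_mul, zero_add, finiteRR, Finset.mul_sum]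
  congr 1
  · refine Finset.sum_congr rfl fun p _ => ?_
    rw [← inv_qPochhammer_succ hq hq p.2]
    ring
  · refine Finset.sum_congr rfl fun p hp => ?_
    rw [← Finset.HasAntidiagonal.mem_antidiagonal.1 hp, ← inv_qPochhammer_succ hq hq p.1]
    ring

theorem eq_finiteRR_of_recursion {q : ℂ} (hq : ‖q‖ < 1) {A B : ℕ → ℂ} (hA0 : A 0 = 1)
    (hB0 : B 0 = 1) (hA : ∀ n, A (n + 1) = A n + q ^ (n + 1) * B (n + 1))
    (hB : ∀ n, B (n + 1) = B n + q ^ (n + 1) * A (n + 1) + q ^ (n + 1) * B (n + 1) -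
      q ^ (2 * (n + 1)) * B (n + 1)) (n : ℕ) :
    A n = finiteRR q 1 n ∧ B n = finiteRR q 0 n := by
  induction n with
  | zero => simp [hA0, hB0, finiteRR_zero]
  | succ n ih =>
    have hne : 1 - q ^ (n + 1) ≠ 0 := by
      simpa [pow_succ'] using one_sub_mul_pow_ne_zero hq hq n
    have hBn : B (n + 1) = finiteRR q 0 (n + 1) := by
      refine mul_left_cancel₀ hne ?_
      rw [finiteRR_zero_succ hq, ← ih.1, ← ih.2]
      -- Substituting `hA` for `A (n + 1)` produces q^{2(n+1)} B_{n+1}, which cancels the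
      -- inclusion–exclusion term.
      linear_combination hB n + q ^ (n + 1) * hA n
    refine ⟨?_, hBn⟩
    rw [hA, finiteRR_one_succ hq, ih.1, hBn]

/-! ### The profiles (2,0,0) and (3,0), and removal of the bound on the parts -/

namespace CylindricPartition

theorem boundedGenFun_two_zero_zero {q : ℂ} (hq : ‖q‖ < 1) (n : ℕ) :
    boundedGenFun ![2, 0, 0] n q = finiteRR q 1 n := by
  refine (eq_finiteRR_of_recursion hq (A := fun n => boundedGenFun ![2, 0, 0] n q)
    (B := fun n => boundedGenFun ![1, 1, 0] n q)
    (boundedGenFun_zero _ q) (boundedGenFun_zero _ q) (fun n => ?_) (fun n => ?_) n).1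
  · refine boundedGenFun_succ_of_dominated (a := 0) (fun L i => ?_) (by decide) n hq
    have h0 : L.row 1 0 ≤ L.row 0 0 := L.row_succ_le 0 0
    have h1 : L.row 2 0 ≤ L.row 1 0 := L.row_succ_le 1 0
    fin_cases i
    exacts [le_rfl, h0, h1.trans h0]
  · have h := boundedGenFun_succ_of_dominated_pair (c := ![1, 1, 0]) (ca := ![0, 2, 0])
      (cb := ![1, 0, 1]) (cab := ![0, 1, 1]) (a := 0) (b := 1) (by decide) (fun L i => ?_)
      (by decide) (by decide) (by decide) n hq
    · rwa [boundedGenFun_rotate (c := ![2, 0, 0]) (c' := ![0, 2, 0]) 2 (by decide),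
        boundedGenFun_rotate (c := ![1, 1, 0]) (c' := ![1, 0, 1]) 1 (by decide),
        boundedGenFun_rotate (c := ![1, 1, 0]) (c' := ![0, 1, 1]) 2 (by decide)] at h
    · have h1 : L.row 2 0 ≤ L.row 1 0 := L.row_succ_le 1 0
      fin_cases i
      exacts [.inl le_rfl, .inr le_rfl, .inr h1]

theorem boundedGenFun_three_zero {q : ℂ} (hq : ‖q‖ < 1) (n : ℕ) :
    boundedGenFun ![3, 0] n q = finiteRR q 1 n := by
  refine (eq_finiteRR_of_recursion hq (A := fun n => boundedGenFun ![3, 0] n q)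
    (B := fun n => boundedGenFun ![2, 1] n q)
    (boundedGenFun_zero _ q) (boundedGenFun_zero _ q) (fun n => ?_) (fun n => ?_) n).1
  · refine boundedGenFun_succ_of_dominated (a := 0) (fun L i => ?_) (by decide) n hq
    have h0 : L.row 1 0 ≤ L.row 0 0 := L.row_succ_le 0 0
    fin_cases i
    exacts [le_rfl, h0]
  · have h := boundedGenFun_succ_of_dominated_pair (c := ![2, 1]) (ca := ![1, 2])
      (cb := ![3, 0]) (cab := ![2, 1]) (a := 0) (b := 1) (by decide) (fun L i => ?_)
      (by decide) (by decide) (by decide) n hq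
    · rw [boundedGenFun_rotate (c := ![2, 1]) (c' := ![1, 2]) 1 (by decide)] at h
      rwa [add_right_comm]
    · fin_cases i
      exacts [.inl le_rfl, .inr le_rfl]

/-- Convergence at `‖q‖`, where all terms are nonnegative, bounds every finite partial sum and gives
absolute summability. Dominated convergence then identifies the limit at `q`. -/
theorem hasSum_of_tendsto_boundedGenFun {r : ℕ} [NeZero r] {c : Fin r → ℕ} {q a b : ℂ}
    (hq : ‖q‖ < 1) (ha : Tendsto (fun n => boundedGenFun c n q) atTop (𝓝 a))
    (hb : Tendsto (fun n => boundedGenFun c n ‖q‖) atTop (𝓝 b)) :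
    HasSum (fun L : CylindricPartition c => q ^ L.size) a := by
  have hx : ‖((‖q‖ : ℝ) : ℂ)‖ < 1 := by simpa using hq
  have hex (L : CylindricPartition c) : ∀ᶠ n in atTop, L ∈ bounded c n := by
    filter_upwards [eventually_ge_atTop (∑ i, L.row i 0)] with n hn i
    exact (Finset.single_le_sum (f := fun i => L.row i 0) (fun _ _ => Nat.zero_le _)
      (Finset.mem_univ i)).trans hn
  have hs : Summable fun L : CylindricPartition c => ‖q‖ ^ L.size := by
    obtain ⟨M, hM⟩ := hb.norm.bddAbove_range
    refine summable_of_sum_le (c := M) (fun L => by positivity) fun s => ?_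
    obtain ⟨n, hn⟩ := ((Filter.eventually_all_finset s).2 fun L _ => hex L).exists
    refine le_trans ?_ (hM ⟨n, rfl⟩)
    have hsum : Summable ((bounded c n).indicator fun L => ‖q‖ ^ L.size) :=
      summable_subtype_iff_indicator.1 (summable_bounded c n (norm_nonneg q) hq)
    calc ∑ L ∈ s, ‖q‖ ^ L.size
        = ∑ L ∈ s, (bounded c n).indicator (fun L => ‖q‖ ^ L.size) L :=
          Finset.sum_congr rfl fun L hL => (Set.indicator_of_mem (hn L hL) fun L => ‖q‖ ^ L.size).symm
      _ ≤ ∑' L, (bounded c n).indicator (fun L => ‖q‖ ^ L.size) L :=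
          hsum.sum_le_tsum s fun L _ => Set.indicator_nonneg (fun _ _ => by positivity) L
      _ = ∑' L : bounded c n, ‖q‖ ^ L.1.size :=
          (tsum_subtype _ fun L : CylindricPartition c => ‖q‖ ^ L.size).symm
      _ ≤ ‖boundedGenFun c n ‖q‖‖ := by
          have : boundedGenFun c n ‖q‖ =
              ((∑' L : bounded c n, ‖q‖ ^ L.1.size : ℝ) : ℂ) := by
            simp [boundedGenFun, Complex.ofReal_tsum]
          rw [this, Complex.norm_real]
          exact le_abs_self _
  have hs' : Summable fun L : CylindricPartition c => q ^ L.size :=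
    Summable.of_norm (by simpa using hs)
  have ht : Tendsto (fun n => boundedGenFun c n q) atTop
      (𝓝 (∑' L : CylindricPartition c, q ^ L.size)) := by
    have : (fun n => boundedGenFun c n q) =
        fun n => ∑' L, (bounded c n).indicator (fun L => q ^ L.size) L :=
      funext fun n => tsum_subtype _ fun L : CylindricPartition c => q ^ L.size
    rw [this]
    refine tendsto_tsum_of_dominated_convergence hs (fun L => ?_) (.of_forall fun n L => ?_)
    · refine tendsto_const_nhds.congr' ?_
      filter_upwards [hex L] with n hn
      exact (Set.indicator_of_mem hn fun L => q ^ L.size).symm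
    · exact (norm_indicator_le_norm_self _ L).trans (norm_pow q _).le
  exact tendsto_nhds_unique ha ht ▸ hs'.hasSum

end CylindricPartition

/-! ### The limit of the finite Rogers–Ramanujan sums -/

theorem tendsto_sum_antidiagonal_mul {f b : ℕ → ℂ} {l : ℂ} (hf : Summable fun k => ‖f k‖)
    (hb : Tendsto b atTop (𝓝 l)) :
    Tendsto (fun n => ∑ p ∈ Finset.HasAntidiagonal.antidiagonal n, f p.1 * b p.2) atTop (𝓝 ((∑' k, f k) * l)) := by
  obtain ⟨C, hC⟩ := hb.norm.bddAbove_range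
  have hC' (m) : ‖b m‖ ≤ C := hC ⟨m, rfl⟩
  have h (n : ℕ) : ∑ p ∈ Finset.HasAntidiagonal.antidiagonal n, f p.1 * b p.2 =
      ∑' k, if k < n + 1 then f k * b (n - k) else 0 := by
    rw [Finset.Nat.sum_antidiagonal_eq_sum_range_succ (fun k m => f k * b m),
      tsum_eq_sum (s := Finset.range (n + 1)) fun k hk => if_neg (by simpa using hk)]
    exact Finset.sum_congr rfl fun k hk => (if_pos (Finset.mem_range.1 hk)).symm
  simp only [h]
  rw [← tsum_mul_right]
  refine tendsto_tsum_of_dominated_convergence (hf.mul_right C) (fun k => ?_)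
    (.of_forall fun n k => ?_)
  · refine ((hb.comp (tendsto_sub_atTop_nat k)).const_mul (f k)).congr' ?_
    filter_upwards [eventually_ge_atTop k] with n hn
    rw [if_pos (by omega)]
    rfl
  · split_ifs
    · rw [norm_mul]
      exact mul_le_mul_of_nonneg_left (hC' _) (norm_nonneg _)
    · rw [norm_zero]
      exact mul_nonneg (norm_nonneg _) ((norm_nonneg _).trans (hC' 0))

theorem summable_norm_pow_div_qPochhammer {a q x : ℂ} (ha : ‖a‖ < 1) (hq : ‖q‖ < 1)
    (hx : ‖x‖ < 1) {e : ℕ → ℕ} (he : ∀ n, n ≤ e n) :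
    Summable fun n => ‖x ^ e n * (qPochhammer a q n)⁻¹‖ := by
  obtain ⟨C, hC⟩ := exists_norm_inv_qPochhammer_le ha hq
  refine ((summable_geometric_of_lt_one (norm_nonneg x) hx).mul_right C).of_nonneg_of_le
    (fun _ => norm_nonneg _) fun n => ?_
  rw [norm_mul, norm_pow]
  exact mul_le_mul (pow_le_pow_of_le_one (norm_nonneg x) hx.le (he n)) (hC n) (norm_nonneg _)
    (by positivity)

theorem tendsto_finiteRR {q : ℂ} (hq : ‖q‖ < 1) :
    Tendsto (finiteRR q 1) atTop
      (𝓝 ((∑' k : ℕ, q ^ (k ^ 2 + 1 * k) * (qPochhammer q q k)⁻¹) * (qPochhammerInf q q)⁻¹)) :=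
  tendsto_sum_antidiagonal_mul (f := fun k => q ^ (k ^ 2 + 1 * k) * (qPochhammer q q k)⁻¹)
    (b := fun m => (qPochhammer q q m)⁻¹)
    (summable_norm_pow_div_qPochhammer hq hq hq fun n => by nlinarith [Nat.zero_le (n ^ 2)])
    ((tendsto_qPochhammer q hq).inv₀ (qPochhammerInf_ne_zero hq hq))

/-! ### Euler's expansion and Rogers' transformation -/

theorem norm_sq_lt_one {q : ℂ} (hq : ‖q‖ < 1) : ‖q ^ 2‖ < 1 := by
  rw [norm_pow]
  exact pow_lt_one₀ (norm_nonneg q) hq two_ne_zero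

/-- Euler's expansion of `(-y q ^ 2; q ^ 2)_∞`. -/
theorem tsum_euler {q : ℂ} (hq : ‖q‖ < 1) {y : ℂ} (hy : ‖y‖ ≤ 1) :
    ∑' m : ℕ, y ^ m * (q ^ (m ^ 2 + m) * (qPochhammer (q ^ 2) (q ^ 2) m)⁻¹) =
      qPochhammerInf (-(y * q ^ 2)) (q ^ 2) := by
  have hq2 := norm_sq_lt_one hq
  set e : ℕ → ℂ := fun m => q ^ (m ^ 2 + m) * (qPochhammer (q ^ 2) (q ^ 2) m)⁻¹ with he
  have hse : Summable fun m => ‖e m‖ :=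
    summable_norm_pow_div_qPochhammer hq2 hq2 hq fun n => Nat.le_add_left _ _
  have hb {y : ℂ} (hy : ‖y‖ ≤ 1) (m : ℕ) : ‖y ^ m * e m‖ ≤ ‖e m‖ := by
    rw [norm_mul, norm_pow]
    exact mul_le_of_le_one_left (norm_nonneg _) (pow_le_one₀ (norm_nonneg y) hy)
  have hs {y : ℂ} (hy : ‖y‖ ≤ 1) : Summable fun m => y ^ m * e m :=
    Summable.of_norm_bounded hse (hb hy)
  have hyq {y : ℂ} (hy : ‖y‖ ≤ 1) : ‖y * q ^ 2‖ ≤ 1 := by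
    rw [norm_mul]
    exact mul_le_one₀ hy (norm_nonneg _) hq2.le
  -- The functional equation G(y) = (1 + y q²) G(y q²) follows from (1 - q^{2m+2}) e_{m+1} =
  -- q^{2m+2} e_m. Iterating it pushes the argument to 0, where G is 1.
  have hfun {y : ℂ} (hy : ‖y‖ ≤ 1) : ∑' m, y ^ m * e m =
      (1 + y * q ^ 2) * ∑' m, (y * q ^ 2) ^ m * e m := by
    have h1 := (hs (hyq hy)).mul_left (y * q ^ 2)
    rw [add_mul, one_mul, ← tsum_mul_left, (hs hy).tsum_eq_zero_add,
      (hs (hyq hy)).tsum_eq_zero_add, add_assoc,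
      ← ((summable_nat_add_iff 1).2 (hs (hyq hy))).tsum_add h1]
    congr 1
    refine tsum_congr fun m => ?_
    simp only [he, ← inv_qPochhammer_succ hq2 hq2 m]
    ring
  have hpow (k : ℕ) : ‖y * (q ^ 2) ^ k‖ ≤ 1 := by
    rw [norm_mul, norm_pow]
    exact mul_le_one₀ hy (by positivity) (pow_le_one₀ (norm_nonneg _) hq2.le)
  have hiter (k : ℕ) : ∑' m, y ^ m * e m =
      qPochhammer (-(y * q ^ 2)) (q ^ 2) k * ∑' m, (y * (q ^ 2) ^ k) ^ m * e m := by
    induction k with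
    | zero => simp [qPochhammer_zero]
    | succ k ih =>
      rw [ih, hfun (hpow k), qPochhammer_succ, pow_succ (q ^ 2), ← mul_assoc y]
      ring
  have hlim : Tendsto (fun k : ℕ => ∑' m, (y * (q ^ 2) ^ k) ^ m * e m) atTop
      (𝓝 (∑' m, (0 : ℂ) ^ m * e m)) := by
    refine tendsto_tsum_of_dominated_convergence hse (fun m => ?_)
      (.of_forall fun k m => hb (hpow k) m)
    have := (tendsto_pow_atTop_nhds_zero_of_norm_lt_one hq2).const_mul y
    rw [mul_zero] at this
    exact (this.pow m).mul_const _
  have h0 : ∑' m, (0 : ℂ) ^ m * e m = 1 := by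
    rw [tsum_eq_single 0 fun m hm => by simp [hm]]
    simp [he, qPochhammer_zero]
  have := (tendsto_qPochhammer (-(y * q ^ 2)) hq2).mul hlim
  rw [h0, mul_one] at this
  exact tendsto_nhds_unique (tendsto_const_nhds.congr hiter) this

/-- This is the coefficient of z^N in 1/(z;q)_∞ = 1/((zq;q²)_∞ (z;q²)_∞). The induction avoids
generating functions: swapping the indices shows that multiplication by 1 - q^{N+1} inserts 1 -
q^{2m}, which lowers `m`. -/
theorem sum_antidiagonal_inv_qPochhammer_sq {q : ℂ} (hq : ‖q‖ < 1) (N : ℕ) :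
    ∑ p ∈ Finset.HasAntidiagonal.antidiagonal N, q ^ p.1 * (qPochhammer (q ^ 2) (q ^ 2) p.1)⁻¹ *
      (qPochhammer (q ^ 2) (q ^ 2) p.2)⁻¹ = (qPochhammer q q N)⁻¹ := by
  have hq2 := norm_sq_lt_one hq
  induction N with
  | zero => simp [qPochhammer_zero]
  | succ N ih =>
    set f : ℕ × ℕ → ℂ := fun p => q ^ p.1 * (qPochhammer (q ^ 2) (q ^ 2) p.1)⁻¹ *
      (qPochhammer (q ^ 2) (q ^ 2) p.2)⁻¹ with hf
    refine mul_right_cancel₀ (one_sub_mul_pow_ne_zero hq hq N) ?_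
    rw [inv_qPochhammer_succ hq hq, ← ih]
    have hswap : q ^ (N + 1) * ∑ p ∈ Finset.HasAntidiagonal.antidiagonal (N + 1), f p =
        ∑ p ∈ Finset.HasAntidiagonal.antidiagonal (N + 1), f p * (q ^ 2) ^ p.2 := by
      rw [← Finset.Nat.sum_antidiagonal_swap, Finset.mul_sum]
      refine Finset.sum_congr rfl fun p hp => ?_
      rw [← Finset.HasAntidiagonal.mem_antidiagonal.1 hp]
      simp only [hf, Prod.fst_swap, Prod.snd_swap]
      ring
    calc (∑ p ∈ Finset.HasAntidiagonal.antidiagonal (N + 1), f p) * (1 - q * q ^ N)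
        = (∑ p ∈ Finset.HasAntidiagonal.antidiagonal (N + 1), f p) -
            q ^ (N + 1) * ∑ p ∈ Finset.HasAntidiagonal.antidiagonal (N + 1), f p := by ring
      _ = ∑ p ∈ Finset.HasAntidiagonal.antidiagonal (N + 1), f p * (1 - (q ^ 2) ^ p.2) := by
          rw [hswap, ← Finset.sum_sub_distrib]
          exact Finset.sum_congr rfl fun p _ => by ring
      _ = ∑ p ∈ Finset.HasAntidiagonal.antidiagonal N, f p := by
          rw [Finset.Nat.sum_antidiagonal_succ']
          simp only [pow_zero, sub_self, mul_zero, zero_add]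
          refine Finset.sum_congr rfl fun p _ => ?_
          simp only [hf]
          rw [← inv_qPochhammer_succ hq2 hq2 p.2]
          ring

theorem qPochhammer_mul_neg (q : ℂ) (n : ℕ) :
    qPochhammer q q n * qPochhammer (-q) q n = qPochhammer (q ^ 2) (q ^ 2) n := by
  simp only [qPochhammer, ← Finset.prod_mul_distrib]
  exact Finset.prod_congr rfl fun k _ => by ring

theorem qPochhammer_mul_qPochhammerInf (a : ℂ) {q : ℂ} (hq : ‖q‖ < 1) (n : ℕ) :
    qPochhammer a q n * qPochhammerInf (a * q ^ n) q = qPochhammerInf a q := by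
  have h1 := (tendsto_qPochhammer (a * q ^ n) hq).const_mul (qPochhammer a q n)
  have h2 := (tendsto_qPochhammer a hq).comp (tendsto_add_atTop_nat n)
  refine tendsto_nhds_unique h1 (h2.congr fun m => ?_)
  simp only [Function.comp, qPochhammer]
  rw [add_comm, Finset.prod_range_add]
  congr 1
  exact Finset.prod_congr rfl fun k _ => by rw [pow_add, mul_assoc]

theorem norm_neg_sq_lt_one {q : ℂ} (hq : ‖q‖ < 1) : ‖-q ^ 2‖ < 1 := by
  rw [norm_neg]
  exact norm_sq_lt_one hq

/-- Rogers' transformation of the second Rogers–Ramanujan sum. -/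
theorem tsum_rogers {q : ℂ} (hq : ‖q‖ < 1) :
    (∑' n : ℕ, q ^ (n ^ 2 + 2 * n) / qPochhammer (q ^ 4) (q ^ 4) n) *
        qPochhammerInf (-q ^ 2) (q ^ 2) =
      ∑' k : ℕ, q ^ (k ^ 2 + 1 * k) * (qPochhammer q q k)⁻¹ := by
  have hq2 := norm_sq_lt_one hq
  set b : ℕ → ℂ := fun m => (qPochhammer (q ^ 2) (q ^ 2) m)⁻¹ with hb
  -- The exponent n² + 2n + 2nm + m² + m equals N² + N + n with N = n + m, so summing along
  -- antidiagonals leaves the sum evaluated by `sum_antidiagonal_inv_qPochhammer_sq`.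
  let F : ℕ × ℕ → ℂ := fun p =>
    q ^ (p.1 ^ 2 + 2 * p.1) * b p.1 * ((q ^ (2 * p.1)) ^ p.2 * (q ^ (p.2 ^ 2 + p.2) * b p.2))
  have hF : Summable F := by
    have h := Summable.mul_of_nonneg
      (summable_norm_pow_div_qPochhammer hq2 hq2 hq (e := fun n => n ^ 2 + 2 * n)
        fun n => by nlinarith [Nat.zero_le (n ^ 2)])
      (summable_norm_pow_div_qPochhammer hq2 hq2 hq (e := fun n => n ^ 2 + n)
        fun n => Nat.le_add_left _ _)
      (fun _ => norm_nonneg _) (fun _ => norm_nonneg _)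
    refine Summable.of_norm_bounded h fun p => ?_
    simp only [F, norm_mul, norm_pow, hb]
    exact mul_le_mul_of_nonneg_left (mul_le_of_le_one_left (by positivity)
      (pow_le_one₀ (by positivity) (pow_le_one₀ (norm_nonneg q) hq.le))) (by positivity)
  calc (∑' n : ℕ, q ^ (n ^ 2 + 2 * n) / qPochhammer (q ^ 4) (q ^ 4) n) *
        qPochhammerInf (-q ^ 2) (q ^ 2)
      = ∑' n, ∑' m, F (n, m) := by
        rw [← tsum_mul_right]
        refine tsum_congr fun n => ?_
        simp only [F]
        -- Euler at y = q^{2n} gives the tail (-q^{2n+2};q²)_∞; its missing first `n` factors cancel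
        -- against (q⁴;q⁴)_n = (q²;q²)_n (-q²;q²)_n.
        rw [tsum_mul_left, tsum_euler hq (y := q ^ (2 * n))
          (by rw [norm_pow]; exact pow_le_one₀ (norm_nonneg q) hq.le),
          show q ^ 4 = (q ^ 2) ^ 2 by ring, ← qPochhammer_mul_neg,
          ← qPochhammer_mul_qPochhammerInf (-q ^ 2) hq2 n, hb,
          show -q ^ 2 * (q ^ 2) ^ n = -(q ^ (2 * n) * q ^ 2) by ring]
        have := qPochhammer_ne_zero (norm_neg_sq_lt_one hq) hq2 n
        have := qPochhammer_ne_zero hq2 hq2 n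
        field_simp
    _ = ∑' p, F p := hF.tsum_prod.symm
    _ = ∑' N, ∑ p ∈ Finset.HasAntidiagonal.antidiagonal N, F p := by
        have he := (Finset.HasAntidiagonal.sigmaAntidiagonalEquivProd (A := ℕ)).summable_iff.2 hF
        rw [← (Finset.HasAntidiagonal.sigmaAntidiagonalEquivProd (A := ℕ)).tsum_eq F]
        exact he.tsum_sigma.trans (tsum_congr fun N => Finset.tsum_subtype _ F)
    _ = ∑' k : ℕ, q ^ (k ^ 2 + 1 * k) * (qPochhammer q q k)⁻¹ := by
        refine tsum_congr fun N => ?_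
        rw [← sum_antidiagonal_inv_qPochhammer_sq hq, Finset.mul_sum]
        refine Finset.sum_congr rfl fun p hp => ?_
        rw [← Finset.HasAntidiagonal.mem_antidiagonal.1 hp]
        simp only [F, hb]
        ring

theorem mainTheorem9 (q : ℂ) (hq : ‖q‖ < 1) :
    Summable (fun n : ℕ => q ^ (n ^ 2 + 2 * n) / qPochhammer (q ^ 4) (q ^ 4) n) ∧
    HasSum (fun L : CylindricPartition ![2, 0, 0] => q ^ L.size)
      ((∑' n : ℕ, q ^ (n ^ 2 + 2 * n) / qPochhammer (q ^ 4) (q ^ 4) n) *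
        (qPochhammerInf (-q ^ 2) (q ^ 2) / qPochhammerInf q q)) ∧
    HasSum (fun L : CylindricPartition ![3, 0] => q ^ L.size)
      ((∑' n : ℕ, q ^ (n ^ 2 + 2 * n) / qPochhammer (q ^ 4) (q ^ 4) n) *
        (qPochhammerInf (-q ^ 2) (q ^ 2) / qPochhammerInf q q)) := by
  have hq4 : ‖q ^ 4‖ < 1 := by
    rw [norm_pow]
    exact pow_lt_one₀ (norm_nonneg q) hq four_ne_zero
  have hx : ‖((‖q‖ : ℝ) : ℂ)‖ < 1 := by simpa using hq
  have hlim := tendsto_finiteRR hq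
  rw [← tsum_rogers hq, ← div_eq_mul_inv, mul_div_assoc] at hlim
  refine ⟨Summable.of_norm ?_, ?_, ?_⟩
  · simpa only [div_eq_mul_inv] using summable_norm_pow_div_qPochhammer hq4 hq4 hq
      (e := fun n => n ^ 2 + 2 * n) fun n => by nlinarith [Nat.zero_le (n ^ 2)]
  · exact CylindricPartition.hasSum_of_tendsto_boundedGenFun hq
      (hlim.congr fun n => (CylindricPartition.boundedGenFun_two_zero_zero hq n).symm)
      ((tendsto_finiteRR hx).congr fun n =>
        (CylindricPartition.boundedGenFun_two_zero_zero hx n).symm)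
  · exact CylindricPartition.hasSum_of_tendsto_boundedGenFun hq
      (hlim.congr fun n => (CylindricPartition.boundedGenFun_three_zero hq n).symm)
      ((tendsto_finiteRR hx).congr fun n =>
        (CylindricPartition.boundedGenFun_three_zero hx n).symm)
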